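/- Let $\mathbb{H}^2_{\mathbb{C}}$ be the complex hyperbolic plane, that is, the unit ball of $\mathbb{C}^2$ with the Bergman distance $d$ given by $\cosh^2\big(d(z,w)/2\big)=\frac{|\langle Z,W\rangle|^2}{\langle Z,Z\rangle\langle W,W\rangle}$, where $\langle Z,W\rangle = Z_0\overline{W_0}+Z_1\overline{W_1}-Z_2\overline{W_2}$, $Z=(z_0,z_1,1)$ and $W=(w_0,w_1,1)$; the group $PU(2,1)$ acts on it by fractional linear transformations. Let $\mathcal{H}=\mathbb{C}\times\mathbb{R}$ be the Heisenberg group with the product $(\xi,v)(\xi',v')=(\xi+\xi',\,v+v'+2\,\mathrm{Im}(\xi\overline{\xi'}))$, embedded in $PU(2,1)$ by $$(\xi,v)\longmapsto\begin{pmatrix}1&\xi&\xi\\ -\bar\xi&1-\tfrac12(|\xi|^2-iv)&-\tfrac12(|\xi|^2-iv)\\ \bar\xi&\tfrac12(|\xi|^2-iv)&1+\tfrac12(|\xi|^2-iv)\end{pmatrix}.$$ **Theorem 3.2.** Let $G\subset PU(2,1)$ be a (necessarily discrete and parabolic) group that is conjugate in $PU(2,1)$ to the subgroup $\Gamma=\{(m,n)\in\mathbb{C}\times\mathbb{R}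 : m,n\in\mathbb{Z}\}$ of $\mathcal{H}$. Then for every center $y\in\mathbb{H}^2_{\mathbb{C}}$ the Dirichlet polyhedron $$D_y(G)=\{x\in\mathbb{H}^2_{\mathbb{C}} : d(x,y)\le d(x,gy)\text{ for all } g\in G\}$$ has infinitely many sides. Here, for $g\in G$ with $gy\ne y$, the set $S=D_y(G)\cap\{x : d(x,y)=d(x,gy)\}$ is a side of $D_y(G)$ if it has codimension one, that is, if it contains a nonempty relatively open subset of the bisector $\{x : d(x,y)=d(x,gy)\}$. -/

import Mathlib

open scoped Matrix ComplexConjugate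

namespace CHyp

/-- The diagonal matrix of the Hermitian form of signature `(2,1)` on `ℂ³`. -/
def J : Matrix (Fin 3) (Fin 3) ℂ := Matrix.diagonal ![1, 1, -1]

/-- The Hermitian form `⟨Z, W⟩ = Z₀ W̄₀ + Z₁ W̄₁ - Z₂ W̄₂` of signature `(2,1)` on `ℂ³`. -/
def herm (Z W : Fin 3 → ℂ) : ℂ := Z 0 * conj (W 0) + Z 1 * conj (W 1) - Z 2 * conj (W 2)

/-- The complex hyperbolic plane, as the open unit ball of `ℂ²` (with the Euclidean norm). -/
def CH2 : Type := {z : EuclideanSpace ℂ (Fin 2) // z ∈ Metric.ball 0 1}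

/-- The topology of the ball, as a subspace of `ℂ²`. -/
instance : TopologicalSpace CH2 :=
  inferInstanceAs (TopologicalSpace {z : EuclideanSpace ℂ (Fin 2) // z ∈ Metric.ball 0 1})

/-- The standard lift `(z₀, z₁, 1) ∈ ℂ³` of a point `(z₀, z₁)` of the ball. -/
def CH2.lift (z : CH2) : Fin 3 → ℂ := ![z.1 0, z.1 1, 1]

/-- The Bergman distance on the ball, normalised so that the sectional curvature lies between
`-1` and `-1/4`: `cosh² (d(z,w) / 2) = |⟨Z, W⟩|² / (⟨Z, Z⟩ ⟨W, W⟩)` for lifts `Z`, `W` of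
`z`, `w`. -/
noncomputable def bergmanDist (z w : CH2) : ℝ :=
  2 * Real.arcosh (‖herm z.lift w.lift‖ /
    Real.sqrt ((herm z.lift z.lift).re * (herm w.lift w.lift).re))

/-- The group `U(2,1)` of complex matrices that preserve the Hermitian form. -/
def U21 : Subgroup (GL (Fin 3) ℂ) where
  carrier := {A | (A : Matrix (Fin 3) (Fin 3) ℂ)ᴴ * J * (A : Matrix (Fin 3) (Fin 3) ℂ) = J}
  one_mem' := by simp
  mul_mem' := by
    intro A B hA hB
    simp only [Set.mem_ofPred_eq, Units.val_mul, Matrix.conjTranspose_mul] at *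
    calc _ = (B : Matrix (Fin 3) (Fin 3) ℂ)ᴴ * ((A : Matrix (Fin 3) (Fin 3) ℂ)ᴴ * J *
              (A : Matrix (Fin 3) (Fin 3) ℂ)) * (B : Matrix (Fin 3) (Fin 3) ℂ) := by
            simp only [Matrix.mul_assoc]
      _ = J := by rw [hA, hB]
  inv_mem' := by
    intro A hA
    simp only [Set.mem_ofPred_eq] at *
    have h1 : (A : Matrix (Fin 3) (Fin 3) ℂ) * ((A⁻¹ : GL (Fin 3) ℂ) : Matrix _ _ ℂ) = 1 :=
      A.mul_inv
    have h2 : ((A⁻¹ : GL (Fin 3) ℂ) : Matrix (Fin 3) (Fin 3) ℂ)ᴴ *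
        (A : Matrix (Fin 3) (Fin 3) ℂ)ᴴ = 1 := by
      rw [← Matrix.conjTranspose_mul, h1, Matrix.conjTranspose_one]
    calc _ = ((A⁻¹ : GL (Fin 3) ℂ) : Matrix (Fin 3) (Fin 3) ℂ)ᴴ *
              ((A : Matrix (Fin 3) (Fin 3) ℂ)ᴴ * J * (A : Matrix (Fin 3) (Fin 3) ℂ)) *
              ((A⁻¹ : GL (Fin 3) ℂ) : Matrix (Fin 3) (Fin 3) ℂ) := by rw [hA]
      _ = (((A⁻¹ : GL (Fin 3) ℂ) : Matrix (Fin 3) (Fin 3) ℂ)ᴴ *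
              (A : Matrix (Fin 3) (Fin 3) ℂ)ᴴ) * J * ((A : Matrix (Fin 3) (Fin 3) ℂ) *
              ((A⁻¹ : GL (Fin 3) ℂ) : Matrix (Fin 3) (Fin 3) ℂ)) := by
            simp only [Matrix.mul_assoc]
      _ = J := by rw [h1, h2, Matrix.one_mul, Matrix.mul_one]

/-- The underlying matrix of an element of `U(2,1)`. -/
def umat (A : U21) : Matrix (Fin 3) (Fin 3) ℂ := ((A : GL (Fin 3) ℂ) : Matrix _ _ ℂ)

theorem umat_one : umat 1 = 1 := rfl

theorem umat_mul (A B : U21) : umat (A * B) = umat A * umat B := rfl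

theorem umat_injective : Function.Injective umat := fun _ _ h =>
  Subtype.ext (Units.ext h)

theorem umat_mem (A : U21) : (umat A)ᴴ * J * umat A = J := A.2

theorem herm_eq (Z W : Fin 3 → ℂ) : herm Z W = star W ⬝ᵥ (J *ᵥ Z) := by
  simp [herm, J, dotProduct, Fin.sum_univ_three, Matrix.mulVec_diagonal]
  ring

theorem herm_mulVec (A : U21) (Z W : Fin 3 → ℂ) :
    herm (umat A *ᵥ Z) (umat A *ᵥ W) = herm Z W := by
  rw [herm_eq, herm_eq, Matrix.star_mulVec, ← Matrix.dotProduct_mulVec, Matrix.mulVec_mulVec,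
    Matrix.mulVec_mulVec, umat_mem A]

theorem herm_self_re (Z : Fin 3 → ℂ) :
    (herm Z Z).re = ‖Z 0‖ ^ 2 + ‖Z 1‖ ^ 2 - ‖Z 2‖ ^ 2 := by
  simp only [herm, Complex.mul_conj, Complex.normSq_eq_norm_sq, Complex.sub_re, Complex.add_re,
    Complex.ofReal_re]

theorem mem_ball_iff (z : EuclideanSpace ℂ (Fin 2)) :
    z ∈ Metric.ball (0 : EuclideanSpace ℂ (Fin 2)) 1 ↔ ‖z 0‖ ^ 2 + ‖z 1‖ ^ 2 < 1 := by
  rw [mem_ball_zero_iff, ← Fin.sum_univ_two (fun i => ‖z i‖ ^ 2), ← EuclideanSpace.norm_sq_eq,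
    sq_lt_one_iff₀ (norm_nonneg _)]

theorem CH2.herm_lift_neg (z : CH2) : (herm z.lift z.lift).re < 0 := by
  have h := (mem_ball_iff z.1).1 z.2
  rw [herm_self_re]
  simp only [CH2.lift, Matrix.cons_val]
  simp
  linarith

theorem coord_two_ne_zero {Z : Fin 3 → ℂ} (h : (herm Z Z).re < 0) : Z 2 ≠ 0 := by
  intro h0
  rw [herm_self_re, h0] at h
  simp at h
  nlinarith [sq_nonneg ‖Z 0‖, sq_nonneg ‖Z 1‖]

/-- The point `(Z₀ / Z₂, Z₁ / Z₂)` of the ball that corresponds to the complex line spanned by a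
negative vector `Z`. -/
noncomputable def CH2.ofNeg (Z : Fin 3 → ℂ) (h : (herm Z Z).re < 0) : CH2 :=
  ⟨!₂[Z 0 / Z 2, Z 1 / Z 2], by
    have h2 := coord_two_ne_zero h
    have h3 : 0 < ‖Z 2‖ ^ 2 := by positivity
    rw [herm_self_re] at h
    rw [mem_ball_iff]
    simp only [Matrix.cons_val, norm_div, div_pow]
    rw [← add_div, div_lt_one h3]
    linarith⟩

theorem CH2.lift_ofNeg (Z : Fin 3 → ℂ) (h : (herm Z Z).re < 0) :
    (CH2.ofNeg Z h).lift = (Z 2)⁻¹ • Z := by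
  have h2 := coord_two_ne_zero h
  funext i
  fin_cases i <;> simp [CH2.lift, CH2.ofNeg, div_eq_inv_mul, h2]

theorem CH2.ofNeg_smul (c : ℂ) (Z W : Fin 3 → ℂ) (hZ : (herm Z Z).re < 0)
    (hW : (herm W W).re < 0) (h : W = c • Z) : CH2.ofNeg W hW = CH2.ofNeg Z hZ := by
  have hc : c ≠ 0 := by
    rintro rfl
    exact coord_two_ne_zero hW (by simp [h])
  apply Subtype.ext
  subst h
  ext i
  fin_cases i <;> simp [CH2.ofNeg, mul_div_mul_left _ _ hc]

theorem CH2.ofNeg_lift (z : CH2) : CH2.ofNeg z.lift z.herm_lift_neg = z := by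
  apply Subtype.ext
  ext i
  fin_cases i <;> simp [CH2.ofNeg, CH2.lift]

theorem neg_mulVec (A : U21) (z : CH2) :
    (herm (umat A *ᵥ z.lift) (umat A *ᵥ z.lift)).re < 0 := by
  rw [herm_mulVec]
  exact z.herm_lift_neg

/-- The action of `U(2,1)` on the ball by fractional linear transformations. -/
noncomputable instance : MulAction U21 CH2 where
  smul A z := CH2.ofNeg (umat A *ᵥ z.lift) (neg_mulVec A z)
  one_smul z := by
    refine (CH2.ofNeg_smul 1 z.lift _ z.herm_lift_neg _ ?_).trans z.ofNeg_lift
    rw [umat_one, Matrix.one_mulVec, one_smul]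
  mul_smul A B z := by
    refine (CH2.ofNeg_smul (((umat B *ᵥ z.lift) 2)⁻¹) _ _ (neg_mulVec (A * B) z)
      (neg_mulVec A (CH2.ofNeg (umat B *ᵥ z.lift) (neg_mulVec B z))) ?_).symm
    rw [CH2.lift_ofNeg, Matrix.mulVec_smul, Matrix.mulVec_mulVec, umat_mul]

theorem U21.smul_def (A : U21) (z : CH2) :
    A • z = CH2.ofNeg (umat A *ᵥ z.lift) (neg_mulVec A z) := rfl

/-- The subgroup of scalar matrices in `U(2,1)`. -/
def scalars : Subgroup U21 where
  carrier := {A | ∃ c : ℂ, umat A = c • (1 : Matrix (Fin 3) (Fin 3) ℂ)}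
  one_mem' := ⟨1, by rw [umat_one, one_smul]⟩
  mul_mem' := by
    rintro A B ⟨a, ha⟩ ⟨b, hb⟩
    exact ⟨a * b, by rw [umat_mul, ha, hb, Matrix.smul_mul, Matrix.one_mul, smul_smul]⟩
  inv_mem' := by
    rintro A ⟨a, ha⟩
    have h1 : umat A * umat A⁻¹ = 1 := by rw [← umat_mul, mul_inv_cancel, umat_one]
    rw [ha, Matrix.smul_mul, Matrix.one_mul] at h1
    have h0 : a ≠ 0 := by
      rintro rfl
      have := congrFun (congrFun h1 0) 0
      simp at this
    exact ⟨a⁻¹, by rw [← h1, smul_smul, inv_mul_cancel₀ h0, one_smul]⟩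

instance : scalars.Normal where
  conj_mem := by
    rintro A ⟨a, ha⟩ B
    refine ⟨a, ?_⟩
    rw [umat_mul, umat_mul, ha, Matrix.mul_smul, Matrix.mul_one, Matrix.smul_mul,
      ← umat_mul, mul_inv_cancel, umat_one]

/-- The projective unitary group `PU(2,1)`. -/
abbrev PU21 : Type := U21 ⧸ scalars

theorem scalars_smul (A : U21) (hA : A ∈ scalars) (z : CH2) : A • z = z := by
  obtain ⟨a, ha⟩ := hA
  refine (CH2.ofNeg_smul a z.lift _ z.herm_lift_neg (neg_mulVec A z) ?_).trans z.ofNeg_lift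
  rw [ha, Matrix.smul_mulVec, Matrix.one_mulVec]

/-- The action of `PU(2,1)` on the ball, induced by that of `U(2,1)`. -/
noncomputable instance : MulAction PU21 CH2 :=
  MulAction.compHom CH2 (QuotientGroup.lift scalars (MulAction.toPermHom U21 CH2)
    (fun A hA => Equiv.ext (scalars_smul A hA)))

theorem PU21.mk_smul (A : U21) (z : CH2) : (QuotientGroup.mk A : PU21) • z = A • z := rfl

/-- The Heisenberg group `ℂ × ℝ`. -/
@[ext] structure Heis where
  /-- the horizontal coordinate -/
  xi : ℂ
  /-- the vertical (central) coordinate -/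
  v : ℝ

/-- The group law `(ξ, v) (ξ', v') = (ξ + ξ', v + v' + 2 Im (ξ ξ̄'))`. -/
noncomputable instance : Group Heis where
  mul p q := ⟨p.xi + q.xi, p.v + q.v + 2 * (p.xi * conj q.xi).im⟩
  one := ⟨0, 0⟩
  inv p := ⟨-p.xi, -p.v⟩
  mul_assoc p q r := by
    apply Heis.ext
    · exact add_assoc _ _ _
    · change p.v + q.v + 2 * (p.xi * conj q.xi).im + r.v + 2 * ((p.xi + q.xi) * conj r.xi).im =
        p.v + (q.v + r.v + 2 * (q.xi * conj r.xi).im) + 2 * (p.xi * conj (q.xi + r.xi)).im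
      simp
      ring
  one_mul p := by
    apply Heis.ext
    · exact zero_add _
    · change 0 + p.v + 2 * (0 * conj p.xi).im = p.v
      simp
  mul_one p := by
    apply Heis.ext
    · exact add_zero _
    · change p.v + 0 + 2 * (p.xi * conj 0).im = p.v
      simp
  inv_mul_cancel p := by
    apply Heis.ext
    · exact neg_add_cancel _
    · change -p.v + p.v + 2 * (-p.xi * conj p.xi).im = 0
      simp [mul_comm]

theorem Heis.mul_def (p q : Heis) :
    p * q = ⟨p.xi + q.xi, p.v + q.v + 2 * (p.xi * conj q.xi).im⟩ := rfl

theorem Heis.one_def : (1 : Heis) = ⟨0, 0⟩ := rfl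

theorem Heis.inv_def (p : Heis) : p⁻¹ = ⟨-p.xi, -p.v⟩ := rfl

/-- The complex number `(|ξ|² - i v) / 2`. -/
noncomputable def Heis.half (p : Heis) : ℂ := (p.xi * conj p.xi - Complex.I * p.v) / 2

/-- The matrix of the Heisenberg translation by `(ξ, v)`. It fixes the null vector
`(0, 1, -1)`, which represents the boundary point `∞`. -/
noncomputable def Heis.mat (p : Heis) : Matrix (Fin 3) (Fin 3) ℂ :=
  !![1, p.xi, p.xi;
     -conj p.xi, 1 - p.half, -p.half;
     conj p.xi, p.half, 1 + p.half]

theorem Heis.mat_one : Heis.mat 1 = 1 := by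
  ext i j
  fin_cases i <;> fin_cases j <;> simp [Heis.mat, Heis.half, Heis.one_def]

theorem Heis.half_mul (p q : Heis) :
    (p * q).half = p.half + q.half + conj p.xi * q.xi := by
  have h : (((p.xi * conj q.xi).im : ℝ) : ℂ) =
      (p.xi * conj q.xi - conj p.xi * q.xi) / (2 * Complex.I) := by
    rw [Complex.im_eq_sub_conj]
    simp
  simp only [Heis.half, Heis.mul_def, Complex.ofReal_add, Complex.ofReal_mul,
    Complex.ofReal_ofNat, h, map_add]
  field_simp
  ring

theorem Heis.mat_mul (p q : Heis) : (p * q).mat = p.mat * q.mat := by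
  have h1 : (p * q).xi = p.xi + q.xi := rfl
  ext i j
  fin_cases i <;> fin_cases j <;>
    simp [Heis.mat, Heis.half_mul, h1, Matrix.mul_apply, Fin.sum_univ_three] <;> ring

theorem Heis.mat_mem (p : Heis) : p.matᴴ * J * p.mat = J := by
  have h : conj p.half = p.xi * conj p.xi - p.half := by
    simp only [Heis.half, map_div₀, map_sub, map_mul, Complex.conj_conj, Complex.conj_I,
      Complex.conj_ofReal, Complex.conj_ofNat]
    ring
  ext i j
  fin_cases i <;> fin_cases j <;>
    simp [Heis.mat, J, Matrix.mul_apply, Fin.sum_univ_three, Matrix.diagonal, h] <;> ring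

/-- The embedding of the Heisenberg group in `U(2,1)`. -/
noncomputable def Heis.toU21 : Heis →* U21 where
  toFun p := ⟨⟨p.mat, p⁻¹.mat, by rw [← Heis.mat_mul, mul_inv_cancel, Heis.mat_one],
    by rw [← Heis.mat_mul, inv_mul_cancel, Heis.mat_one]⟩, p.mat_mem⟩
  map_one' := umat_injective Heis.mat_one
  map_mul' p q := umat_injective (Heis.mat_mul p q)

/-- The Heisenberg group as a group of elements of `PU(2,1)`. -/
noncomputable def Heis.toPU21 : Heis →* PU21 := (QuotientGroup.mk' scalars).comp Heis.toU21

/-- The integer lattice `{(m, n) : m, n ∈ ℤ}` in the Heisenberg group `ℂ × ℝ`. -/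
def integerLattice : Subgroup Heis where
  carrier := {p | ∃ m n : ℤ, p = ⟨(m : ℂ), (n : ℝ)⟩}
  one_mem' := ⟨0, 0, by simp [Heis.one_def]⟩
  mul_mem' := by
    rintro _ _ ⟨m, n, rfl⟩ ⟨m', n', rfl⟩
    exact ⟨m + m', n + n', by simp [Heis.mul_def]⟩
  inv_mem' := by
    rintro _ ⟨m, n, rfl⟩
    exact ⟨-m, -n, by simp [Heis.inv_def]⟩

/-- The Dirichlet polyhedron of `G` centered at `y`. -/
def dirichlet (G : Subgroup PU21) (y : CH2) : Set CH2 :=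
  {x | ∀ g ∈ G, bergmanDist x y ≤ bergmanDist x (g • y)}

/-- The bisector of two points. -/
def bisector (y w : CH2) : Set CH2 := {x | bergmanDist x y = bergmanDist x w}

/-- `S` is a side of the Dirichlet polyhedron of `G` centered at `y`: the part of the polyhedron
that lies in the bisector of `y` and another point `g y` of its orbit, provided that this part has
codimension one, that is, contains a nonempty relatively open piece of the bisector (which is a
smooth real hypersurface). -/
def IsSide (G : Subgroup PU21) (y : CH2) (S : Set CH2) : Prop :=
  ∃ g ∈ G, g • y ≠ y ∧ S = dirichlet G y ∩ bisector y (g • y) ∧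
    ∃ U : Set CH2, IsOpen U ∧ (U ∩ bisector y (g • y)).Nonempty ∧ U ∩ bisector y (g • y) ⊆ S

end CHyp

/-!
The group `PU(2,1)` acts by isometric homeomorphisms, so conjugating reduces the problem to
`G = Γ` with an arbitrary center. Horospherical coordinates at the fixed point `(0, 1, -1)` of the
Heisenberg group identify the ball with `Heis × (0, ∞)`. The group acts by left translations of the
first factor, and `cosh² (d / 2)` for the points `(p, u)` and `(q, w)` is
`((|ξ|² + u + w)² + v²) / (4 u w)` with `(ξ, v) = q⁻¹ p`. Comparing the distances of `x` to the
points of the orbit `Γ y` thus amounts to comparing the values of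
`((a - m)² + R)² + (τ + m β - n)²` at integers `m`, `n`, where `a`, `R ≥ 0`, `τ`, `β` depend on `x`
and `y`. For `a` near `1 / 2` only `m = 0` and `m = 1` compete: every other `m` costs at least `1`
in the first square, more than a `v`-term reduced modulo `1` can be worth. If moreover `τ` is near
`0` and `β` near `n`, the two competitors are `(0, 0)` and `(1, n)`, and their bisector
contributes a side. As `β` takes all real values, every `n` occurs.
-/

namespace CHyp

open scoped Pointwise

section Isometries

theorem herm_smul_smul (c d : ℂ) (Z W : Fin 3 → ℂ) :
    herm (c • Z) (d • W) = c * conj d * herm Z W := by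
  simp only [herm, Pi.smul_apply, smul_eq_mul, map_mul]
  ring

theorem herm_smul_smul_self_re (c : ℂ) (Z : Fin 3 → ℂ) :
    (herm (c • Z) (c • Z)).re = ‖c‖ ^ 2 * (herm Z Z).re := by
  rw [herm_smul_smul, Complex.mul_conj, Complex.re_ofReal_mul, Complex.normSq_eq_norm_sq]

theorem bergmanDist_ofNeg {Z W : Fin 3 → ℂ} (hZ : (herm Z Z).re < 0) (hW : (herm W W).re < 0) :
    bergmanDist (CH2.ofNeg Z hZ) (CH2.ofNeg W hW) =
      2 * Real.arcosh (‖herm Z W‖ / √((herm Z Z).re * (herm W W).re)) := by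
  have hc : ‖(Z 2)⁻¹‖ * ‖(W 2)⁻¹‖ ≠ 0 := mul_ne_zero
    (norm_ne_zero_iff.2 (inv_ne_zero (coord_two_ne_zero hZ)))
    (norm_ne_zero_iff.2 (inv_ne_zero (coord_two_ne_zero hW)))
  rw [bergmanDist, CH2.lift_ofNeg, CH2.lift_ofNeg, herm_smul_smul, herm_smul_smul_self_re,
    herm_smul_smul_self_re, mul_mul_mul_comm, ← mul_pow, Real.sqrt_mul (sq_nonneg _),
    Real.sqrt_sq (by positivity), norm_mul, norm_mul, RCLike.norm_conj, mul_div_mul_left _ _ hc]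

theorem bergmanDist_smul_smul (g : PU21) (x y : CH2) :
    bergmanDist (g • x) (g • y) = bergmanDist x y := by
  obtain ⟨A, rfl⟩ := QuotientGroup.mk_surjective g
  rw [PU21.mk_smul, PU21.mk_smul, U21.smul_def, U21.smul_def, bergmanDist_ofNeg, herm_mulVec,
    herm_mulVec, herm_mulVec, bergmanDist]

theorem CH2.continuous_apply (i : Fin 2) : Continuous fun z : CH2 => z.1 i :=
  (EuclideanSpace.proj (𝕜 := ℂ) i).continuous.comp continuous_subtype_val

theorem CH2.continuous_lift : Continuous CH2.lift := by
  refine continuous_pi fun i => ?_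
  fin_cases i
  exacts [CH2.continuous_apply 0, CH2.continuous_apply 1, continuous_const]

instance : ContinuousConstSMul PU21 CH2 where
  continuous_const_smul g := by
    obtain ⟨A, rfl⟩ := QuotientGroup.mk_surjective g
    have hA (i : Fin 3) : Continuous fun z : CH2 => (umat A *ᵥ z.lift) i :=
      (continuous_apply i).comp (continuous_const.matrix_mulVec CH2.continuous_lift)
    have hdiv (i : Fin 3) :
        Continuous fun z : CH2 => (umat A *ᵥ z.lift) i / (umat A *ᵥ z.lift) 2 :=
      (hA i).div (hA 2) fun z => coord_two_ne_zero (neg_mulVec A z)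
    refine continuous_induced_rng.2
      ((PiLp.continuous_toLp 2 _).comp (continuous_pi fun i => ?_))
    fin_cases i
    exacts [hdiv 0, hdiv 1]

theorem bisector_smul_smul (h : PU21) (y w : CH2) :
    bisector (h • y) (h • w) = h • bisector y w := by
  ext x
  obtain ⟨x, rfl⟩ := MulAction.surjective h x
  simp only [bisector, Set.smul_mem_smul_set_iff, Set.mem_ofPred_eq, bergmanDist_smul_smul]

theorem dirichlet_conj_smul (G : Subgroup PU21) (h : PU21) (y : CH2) :
    dirichlet (G.map (MulAut.conj h).toMonoidHom) (h • y) = h • dirichlet G y := by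
  ext x
  obtain ⟨x, rfl⟩ := MulAction.surjective h x
  simp only [dirichlet, Set.smul_mem_smul_set_iff, Set.mem_ofPred_eq, Subgroup.mem_map,
    forall_exists_index, and_imp, forall_apply_eq_imp_iff₂, MulEquiv.coe_toMonoidHom,
    MulAut.conj_apply, ← mul_smul, inv_mul_cancel_right]
  simp only [mul_smul, bergmanDist_smul_smul]

theorem IsSide.conj_smul {G : Subgroup PU21} {y : CH2} {S : Set CH2} (hS : IsSide G y S)
    (h : PU21) : IsSide (G.map (MulAut.conj h).toMonoidHom) (h • y) (h • S) := by
  obtain ⟨g, hg, hgy, rfl, U, hU, hne, hsub⟩ := hS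
  have hconj : MulAut.conj h g • h • y = h • g • y := by simp [← mul_smul]
  refine ⟨MulAut.conj h g, Subgroup.mem_map_of_mem _ hg, ?_, ?_, h • U, hU.smul h, ?_, ?_⟩
  all_goals rw [hconj]
  · exact (MulAction.injective h).ne hgy
  · rw [dirichlet_conj_smul, bisector_smul_smul, Set.smul_set_inter]
  · rw [bisector_smul_smul, ← Set.smul_set_inter]
    exact hne.smul_set
  · rw [bisector_smul_smul, ← Set.smul_set_inter]
    exact Set.smul_set_mono hsub

theorem infinite_isSide_conj {G : Subgroup PU21} (hG : ∀ y, {S | IsSide G y S}.Infinite)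
    (h : PU21) (y : CH2) : {S | IsSide (G.map (MulAut.conj h).toMonoidHom) y S}.Infinite := by
  refine ((hG (h⁻¹ • y)).image (MulAction.injective h).injOn).mono ?_
  rintro _ ⟨S, hS, rfl⟩
  simpa only [smul_inv_smul] using! hS.conj_smul h

end Isometries

section Horospherical

/-- The vector `(ξ, v) · (0, (1 - u) / 2, (1 + u) / 2)`: the lift, normalised by `Z₁ + Z₂ = 1`, of
the point with horospherical coordinates `(ξ, v)` and `u`, relative to the boundary point
`(0, 1, -1)`. -/
noncomputable def horoVec (p : Heis) (u : ℝ) : Fin 3 → ℂ :=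
  ![p.xi, (1 - u) / 2 - p.half, (1 + u) / 2 + p.half]

/-- The fourth power `|ξ|⁴ + v²` of the Cygan gauge of `(ξ, v)`, with `|ξ|²` shifted by `t` to
account for the heights of two points of the ball. -/
noncomputable def Heis.gauge (t : ℝ) (p : Heis) : ℝ := (‖p.xi‖ ^ 2 + t) ^ 2 + p.v ^ 2

theorem Heis.gauge_pos {t : ℝ} (ht : 0 < t) (p : Heis) : 0 < p.gauge t := by
  rw [Heis.gauge]
  positivity

theorem Heis.two_mul_half (p : Heis) : 2 * p.half = ((‖p.xi‖ ^ 2 : ℝ) : ℂ) - Complex.I * p.v := by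
  rw [Heis.half, mul_div_cancel₀ _ two_ne_zero, Complex.mul_conj, Complex.normSq_eq_norm_sq]

theorem Heis.norm_add_two_mul_half_sq (t : ℝ) (p : Heis) :
    ‖(t : ℂ) + 2 * p.half‖ ^ 2 = p.gauge t := by
  rw [Heis.two_mul_half, ← Complex.normSq_eq_norm_sq, Complex.normSq_apply, Heis.gauge]
  simp only [Complex.add_re, Complex.ofReal_re, Complex.sub_re, Complex.mul_re, Complex.I_re,
    Complex.I_im, Complex.ofReal_im, Complex.add_im, Complex.sub_im, Complex.mul_im]
  ring

theorem mat_mulVec_horoVec (p q : Heis) (u : ℝ) : p.mat *ᵥ horoVec q u = horoVec (p * q) u := by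
  have hxi : (p * q).xi = p.xi + q.xi := rfl
  ext i
  fin_cases i <;>
    simp [horoVec, Heis.mat, Heis.half_mul, hxi, Matrix.mulVec, dotProduct,
      Fin.sum_univ_three] <;>
    ring

theorem herm_horoVec (p q : Heis) (u w : ℝ) :
    herm (horoVec p u) (horoVec q w) = -((u + w : ℝ) + 2 * (q⁻¹ * p).half) / 2 := by
  rw [Heis.half_mul]
  simp only [herm, horoVec, Heis.half, Heis.inv_def, Matrix.cons_val, map_add, map_sub, map_neg,
    map_mul, map_div₀, map_one, Complex.conj_ofReal, Complex.conj_ofNat, Complex.conj_I,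
    Complex.conj_conj, Complex.ofReal_add, Complex.ofReal_neg]
  ring

theorem herm_horoVec_self_re (p : Heis) (u : ℝ) : (herm (horoVec p u) (horoVec p u)).re = -u := by
  rw [herm_horoVec, inv_mul_cancel]
  simp [Heis.half, Heis.one_def]

theorem norm_herm_horoVec (p q : Heis) (u w : ℝ) :
    ‖herm (horoVec p u) (horoVec q w)‖ = √((q⁻¹ * p).gauge (u + w)) / 2 := by
  rw [herm_horoVec, norm_div, norm_neg, ← Heis.norm_add_two_mul_half_sq,
    Real.sqrt_sq (norm_nonneg _), Complex.norm_two]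

theorem herm_horoVec_self_neg (p : Heis) {u : ℝ} (hu : 0 < u) :
    (herm (horoVec p u) (horoVec p u)).re < 0 := by
  rw [herm_horoVec_self_re]
  exact neg_lt_zero.2 hu

theorem horoVec_two_ne_zero (p : Heis) {u : ℝ} (hu : 0 < u) : horoVec p u 2 ≠ 0 :=
  coord_two_ne_zero (herm_horoVec_self_neg p hu)

/-- The point of the ball with horospherical coordinates `p` and `u`. -/
noncomputable def CH2.ofHoro (p : Heis) (u : ℝ) (hu : 0 < u) : CH2 :=
  CH2.ofNeg (horoVec p u) (herm_horoVec_self_neg p hu)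

theorem toPU21_smul_ofHoro (g p : Heis) {u : ℝ} (hu : 0 < u) :
    Heis.toPU21 g • CH2.ofHoro p u hu = CH2.ofHoro (g * p) u hu := by
  refine CH2.ofNeg_smul ((horoVec p u 2)⁻¹) _ _ _ (neg_mulVec _ _) ?_
  rw [CH2.ofHoro, CH2.lift_ofNeg, Matrix.mulVec_smul, ← mat_mulVec_horoVec]
  rfl

theorem CH2.one_add_ne_zero (z : CH2) : 1 + z.1 1 ≠ 0 := by
  intro h
  have hz := (mem_ball_iff z.1).1 z.2
  rw [eq_neg_of_add_eq_zero_right h, norm_neg, norm_one] at hz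
  linarith [sq_nonneg ‖z.1 0‖]

/-- The Cayley transform `(1 - z₁) / (1 + z₁)`, which is `u + |ξ|² - i v` in horospherical
coordinates. -/
noncomputable def CH2.cayley (z : CH2) : ℂ := (1 - z.1 1) / (1 + z.1 1)

/-- The Heisenberg component of the horospherical coordinates. -/
noncomputable def CH2.heis (z : CH2) : Heis := ⟨z.1 0 / (1 + z.1 1), -z.cayley.im⟩

/-- The height `u` among the horospherical coordinates. -/
noncomputable def CH2.height (z : CH2) : ℝ := z.cayley.re - ‖z.heis.xi‖ ^ 2

theorem CH2.height_add_two_mul_half (z : CH2) : z.height + 2 * z.heis.half = z.cayley := by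
  rw [Heis.two_mul_half]
  apply Complex.ext <;> simp [CH2.height, CH2.heis, -Complex.ofReal_pow]

theorem CH2.lift_eq_smul_horoVec (z : CH2) :
    z.lift = (1 + z.1 1) • horoVec z.heis z.height := by
  have h := z.one_add_ne_zero
  have hc : (1 + z.1 1) * (z.height + 2 * z.heis.half) = 1 - z.1 1 := by
    rw [z.height_add_two_mul_half, CH2.cayley, mul_div_cancel₀ _ h]
  ext i
  fin_cases i
  · simp [CH2.lift, horoVec, CH2.heis, mul_div_cancel₀ _ h]
  · simp only [CH2.lift, horoVec, Fin.mk_one, Matrix.cons_val, Pi.smul_apply, smul_eq_mul]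
    linear_combination hc / 2
  · simp only [CH2.lift, horoVec, Fin.reduceFinMk, Matrix.cons_val, Pi.smul_apply,
      smul_eq_mul]
    linear_combination -hc / 2

theorem CH2.height_pos (z : CH2) : 0 < z.height := by
  have h := z.herm_lift_neg
  rw [z.lift_eq_smul_horoVec, herm_smul_smul_self_re, herm_horoVec_self_re, mul_neg,
    neg_lt_zero] at h
  exact pos_of_mul_pos_right h (sq_nonneg _)

theorem CH2.ofHoro_heis_height (z : CH2) : CH2.ofHoro z.heis z.height z.height_pos = z :=
  (CH2.ofNeg_smul _ _ _ _ z.herm_lift_neg z.lift_eq_smul_horoVec).symm.trans z.ofNeg_lift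

theorem CH2.one_add_ofHoro (p : Heis) {u : ℝ} (hu : 0 < u) :
    1 + (CH2.ofHoro p u hu).1 1 = (horoVec p u 2)⁻¹ := by
  have h := horoVec_two_ne_zero p hu
  change 1 + horoVec p u 1 / horoVec p u 2 = _
  field_simp
  simp only [horoVec, Matrix.cons_val]
  ring

theorem CH2.cayley_ofHoro (p : Heis) {u : ℝ} (hu : 0 < u) :
    (CH2.ofHoro p u hu).cayley = u + 2 * p.half := by
  have h := horoVec_two_ne_zero p hu
  rw [CH2.cayley, CH2.one_add_ofHoro, div_inv_eq_mul]
  change (1 - horoVec p u 1 / horoVec p u 2) * horoVec p u 2 = _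
  rw [sub_mul, div_mul_cancel₀ _ h]
  simp only [horoVec, Matrix.cons_val]
  ring

theorem CH2.heis_ofHoro (p : Heis) {u : ℝ} (hu : 0 < u) : (CH2.ofHoro p u hu).heis = p := by
  have h := horoVec_two_ne_zero p hu
  apply Heis.ext
  · rw [CH2.heis, CH2.one_add_ofHoro, div_inv_eq_mul]
    exact div_mul_cancel₀ (horoVec p u 0) h
  · rw [CH2.heis, CH2.cayley_ofHoro, Heis.two_mul_half]
    simp [-Complex.ofReal_pow]

theorem CH2.height_ofHoro (p : Heis) {u : ℝ} (hu : 0 < u) : (CH2.ofHoro p u hu).height = u := by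
  rw [CH2.height, CH2.heis_ofHoro, CH2.cayley_ofHoro, Heis.two_mul_half]
  simp [-Complex.ofReal_pow]

theorem CH2.heis_toPU21_smul (g : Heis) (z : CH2) : (Heis.toPU21 g • z).heis = g * z.heis := by
  conv_lhs => rw [← z.ofHoro_heis_height, toPU21_smul_ofHoro, CH2.heis_ofHoro]

theorem CH2.height_toPU21_smul (g : Heis) (z : CH2) :
    (Heis.toPU21 g • z).height = z.height := by
  conv_lhs => rw [← z.ofHoro_heis_height, toPU21_smul_ofHoro, CH2.height_ofHoro]

theorem CH2.continuous_heis_xi : Continuous fun z : CH2 => z.heis.xi :=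
  (CH2.continuous_apply 0).div (continuous_const.add (CH2.continuous_apply 1))
    CH2.one_add_ne_zero

theorem CH2.continuous_heis_v : Continuous fun z : CH2 => z.heis.v :=
  (Complex.continuous_im.comp ((continuous_const.sub (CH2.continuous_apply 1)).div
    (continuous_const.add (CH2.continuous_apply 1)) CH2.one_add_ne_zero)).neg

theorem bergmanDist_eq_arcosh_gauge (x y : CH2) :
    bergmanDist x y = 2 * Real.arcosh (√((y.heis⁻¹ * x.heis).gauge (x.height + y.height)) / 2 /
      √(x.height * y.height)) := by
  conv_lhs => rw [← x.ofHoro_heis_height, ← y.ofHoro_heis_height]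
  rw [CH2.ofHoro, CH2.ofHoro, bergmanDist_ofNeg, norm_herm_horoVec, herm_horoVec_self_re,
    herm_horoVec_self_re, neg_mul_neg]

theorem bergmanDist_le_iff_of_height_eq (x : CH2) {y w : CH2} (h : w.height = y.height) :
    bergmanDist x y ≤ bergmanDist x w ↔ (y.heis⁻¹ * x.heis).gauge (x.height + y.height) ≤
      (w.heis⁻¹ * x.heis).gauge (x.height + y.height) := by
  have hx := x.height_pos
  have hy := y.height_pos
  have hgauge (p : Heis) := p.gauge_pos (add_pos hx hy)
  have hpos (p : Heis) :
      0 < √(p.gauge (x.height + y.height)) / 2 / √(x.height * y.height) := by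
    have := hgauge p
    positivity
  rw [bergmanDist_eq_arcosh_gauge, bergmanDist_eq_arcosh_gauge, h,
    mul_le_mul_iff_right₀ two_pos, Real.arcosh_le_arcosh (hpos _) (hpos _),
    div_le_div_iff_of_pos_right (Real.sqrt_pos.2 (mul_pos hx hy)),
    div_le_div_iff_of_pos_right two_pos, Real.sqrt_le_sqrt_iff (hgauge _).le]

end Horospherical

section LatticeForm

/-- The value at the lattice point `(m, n)` of the gauge that compares the distances from a point
to an orbit of the integer lattice. -/
def latticeForm (a R τ β : ℝ) (m n : ℤ) : ℝ := ((a - m) ^ 2 + R) ^ 2 + (τ + m * β - n) ^ 2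

theorem sq_le_sub_intCast_sq {t : ℝ} (ht : |t| ≤ 1 / 2) (k : ℤ) : t ^ 2 ≤ (t - k) ^ 2 := by
  rcases eq_or_ne k 0 with rfl | hk
  · simp
  · have hk : (1 : ℝ) ≤ |(k : ℝ)| := mod_cast Int.one_le_abs hk
    have htri := abs_sub_abs_le_abs_sub (k : ℝ) t
    rw [abs_sub_comm] at htri
    exact sq_le_sq.2 (by linarith)

variable {a R τ β : ℝ}

theorem latticeForm_zero_zero_le_of_sq_add_one_le (hR : 0 ≤ R) (hτ : |τ| ≤ 1) {m : ℤ}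
    (hm : a ^ 2 + 1 ≤ (a - m) ^ 2) (n : ℤ) :
    latticeForm a R τ β 0 0 ≤ latticeForm a R τ β m n := by
  have hτ' : τ ^ 2 ≤ 1 := (sq_le_one_iff_abs_le_one τ).2 hτ
  calc latticeForm a R τ β 0 0 = (a ^ 2 + R) ^ 2 + τ ^ 2 := by simp [latticeForm]
    _ ≤ (a ^ 2 + 1 + R) ^ 2 := by nlinarith [sq_nonneg a]
    _ ≤ ((a - m) ^ 2 + R) ^ 2 := by gcongr
    _ ≤ latticeForm a R τ β m n := le_add_of_nonneg_right (sq_nonneg _)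

theorem latticeForm_zero_zero_le_zero (hτ : |τ| ≤ 1 / 2) (n : ℤ) :
    latticeForm a R τ β 0 0 ≤ latticeForm a R τ β 0 n := by
  simpa [latticeForm] using sq_le_sub_intCast_sq hτ n

theorem latticeForm_one_le_one {n₀ : ℤ} (hβ : |τ + β - n₀| ≤ 1 / 2) (n : ℤ) :
    latticeForm a R τ β 1 n₀ ≤ latticeForm a R τ β 1 n := by
  simpa [latticeForm] using sq_le_sub_intCast_sq hβ (n - n₀)

theorem latticeForm_zero_zero_le {n₀ : ℤ} (hR : 0 ≤ R) (ha : |a - 1 / 2| ≤ 1 / 4)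
    (hτ : |τ| ≤ 1 / 2) (hβ : |τ + β - n₀| ≤ 1 / 2)
    (h : latticeForm a R τ β 0 0 = latticeForm a R τ β 1 n₀) (m n : ℤ) :
    latticeForm a R τ β 0 0 ≤ latticeForm a R τ β m n := by
  obtain ⟨ha₀, ha₁⟩ := abs_le.1 ha
  have far (hm : a ^ 2 + 1 ≤ (a - m) ^ 2) :=
    latticeForm_zero_zero_le_of_sq_add_one_le (β := β) hR (by linarith : |τ| ≤ 1) hm n
  obtain hm | rfl | rfl | hm : m ≤ -1 ∨ m = 0 ∨ m = 1 ∨ 2 ≤ m := by omega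
  · have hm : (m : ℝ) ≤ -1 := mod_cast hm
    exact far (by nlinarith)
  · exact latticeForm_zero_zero_le_zero hτ n
  · exact h.trans_le (latticeForm_one_le_one hβ n)
  · have hm : (2 : ℝ) ≤ m := mod_cast hm
    exact far (by nlinarith)

end LatticeForm

section IntegerLattice

/-- The group `Γ` of the integer lattice, as a group of isometries of the ball. -/
noncomputable def latticeGroup : Subgroup PU21 := integerLattice.map Heis.toPU21

/-- The element `(m, n)` of the integer lattice. -/
def latticePt (m n : ℤ) : Heis := ⟨m, n⟩

theorem latticePt_zero_zero : latticePt 0 0 = 1 := by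
  simp [latticePt, Heis.one_def]

theorem mem_latticeGroup_iff (g : PU21) :
    g ∈ latticeGroup ↔ ∃ m n : ℤ, Heis.toPU21 (latticePt m n) = g :=
  ⟨by rintro ⟨_, ⟨m, n, rfl⟩, rfl⟩; exact ⟨m, n, rfl⟩,
    by rintro ⟨m, n, rfl⟩; exact ⟨_, ⟨m, n, rfl⟩, rfl⟩⟩

theorem gauge_inv_latticePt_mul (t : ℝ) (m n : ℤ) (p q : Heis) :
    ((latticePt m n * q)⁻¹ * p).gauge t =
      latticeForm (q⁻¹ * p).xi.re ((q⁻¹ * p).xi.im ^ 2 + t) (q⁻¹ * p).v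
        (2 * (p.xi + q.xi).im) m n := by
  simp only [Heis.gauge, latticeForm, ← Complex.normSq_eq_norm_sq, Complex.normSq_apply]
  simp only [latticePt, Heis.mul_def, Heis.inv_def, Complex.add_re, Complex.add_im, Complex.neg_re,
    Complex.neg_im, Complex.mul_im, Complex.conj_re, Complex.conj_im, Complex.intCast_re,
    Complex.intCast_im]
  ring

/-- The position `q⁻¹ p` of `x` relative to `y` in the Heisenberg group, where `p` and `q` are the
Heisenberg components of `x` and `y`. -/
noncomputable def relHeis (x y : CH2) : Heis := y.heis⁻¹ * x.heis

/-- The rate at which the vertical component of the position of `x` relative to `(m, n) y` changes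
with `m`. -/
noncomputable def shear (x y : CH2) : ℝ := 2 * (x.heis.xi + y.heis.xi).im

/-- The form in `(m, n)` that measures the distance from `x` to `(m, n) y`. -/
noncomputable def orbitForm (x y : CH2) (m n : ℤ) : ℝ :=
  latticeForm (relHeis x y).xi.re ((relHeis x y).xi.im ^ 2 + (x.height + y.height))
    (relHeis x y).v (shear x y) m n

theorem bergmanDist_latticePt_smul_le_iff (x y : CH2) (m n m' n' : ℤ) :
    bergmanDist x (Heis.toPU21 (latticePt m n) • y) ≤
        bergmanDist x (Heis.toPU21 (latticePt m' n') • y) ↔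
      orbitForm x y m n ≤ orbitForm x y m' n' := by
  rw [bergmanDist_le_iff_of_height_eq, CH2.heis_toPU21_smul, CH2.heis_toPU21_smul,
    gauge_inv_latticePt_mul, gauge_inv_latticePt_mul, CH2.height_toPU21_smul]
  · rfl
  · rw [CH2.height_toPU21_smul, CH2.height_toPU21_smul]

theorem latticePt_zero_zero_smul (y : CH2) : Heis.toPU21 (latticePt 0 0) • y = y := by
  rw [latticePt_zero_zero, map_one, one_smul]

theorem mem_dirichlet_latticeGroup_iff (x y : CH2) :
    x ∈ dirichlet latticeGroup y ↔ ∀ m n : ℤ, orbitForm x y 0 0 ≤ orbitForm x y m n := by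
  simp only [dirichlet, Set.mem_ofPred_eq, mem_latticeGroup_iff,
    ← bergmanDist_latticePt_smul_le_iff, latticePt_zero_zero_smul]
  exact ⟨fun h m n => h _ ⟨m, n, rfl⟩, by rintro h _ ⟨m, n, rfl⟩; exact h m n⟩

theorem mem_bisector_latticePt_smul_iff (x y : CH2) (m n : ℤ) :
    x ∈ bisector y (Heis.toPU21 (latticePt m n) • y) ↔ orbitForm x y 0 0 = orbitForm x y m n := by
  simp only [bisector, Set.mem_ofPred_eq, le_antisymm_iff, ← bergmanDist_latticePt_smul_le_iff,
    latticePt_zero_zero_smul]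

/-- A region at whose points `y` or `(1, n) y` is nearest among the lattice translates of `y`. -/
def sideNhd (y : CH2) (n : ℤ) : Set CH2 :=
  {x | |(relHeis x y).xi.re - 1 / 2| < 1 / 4 ∧ |(relHeis x y).v| < 1 / 2 ∧
    |(relHeis x y).v + shear x y - n| < 1 / 2}

theorem isOpen_sideNhd (y : CH2) (n : ℤ) : IsOpen (sideNhd y n) := by
  have hxi := CH2.continuous_heis_xi
  have hv := CH2.continuous_heis_v
  have hre : Continuous fun x => (relHeis x y).xi.re := by
    simp only [relHeis, Heis.mul_def]
    fun_prop
  have hrel : Continuous fun x => (relHeis x y).v := by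
    simp only [relHeis, Heis.mul_def]
    fun_prop
  have hshear : Continuous fun x => shear x y := by
    simp only [shear]
    fun_prop
  exact (isOpen_lt (hre.sub continuous_const).abs continuous_const).inter
    ((isOpen_lt hrel.abs continuous_const).inter
      (isOpen_lt ((hrel.add hshear).sub continuous_const).abs continuous_const))

theorem sideNhd_inter_bisector_subset_dirichlet (y : CH2) (n : ℤ) :
    sideNhd y n ∩ bisector y (Heis.toPU21 (latticePt 1 n) • y) ⊆ dirichlet latticeGroup y := by
  rintro x ⟨⟨ha, hτ, hβ⟩, hx⟩
  have hR : 0 ≤ (relHeis x y).xi.im ^ 2 + (x.height + y.height) :=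
    add_nonneg (sq_nonneg _) (add_pos x.height_pos y.height_pos).le
  rw [mem_bisector_latticePt_smul_iff] at hx
  rw [mem_dirichlet_latticeGroup_iff]
  exact latticeForm_zero_zero_le hR ha.le hτ.le hβ.le hx

theorem exists_relHeis_eq_and_shear_eq (y : CH2) (a β : ℝ) :
    ∃ x, (relHeis x y).xi.re = a ∧ (relHeis x y).v = 0 ∧ shear x y = β := by
  refine ⟨CH2.ofHoro (y.heis * ⟨⟨a, β / 2 - 2 * y.heis.xi.im⟩, 0⟩) 1 one_pos, ?_⟩
  rw [relHeis, shear, CH2.heis_ofHoro, inv_mul_cancel_left]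
  refine ⟨rfl, rfl, ?_⟩
  simp only [Heis.mul_def, Complex.add_im]
  ring

theorem exists_mem_sideNhd_forall_mem_bisector_iff (y : CH2) (n : ℤ) :
    ∃ x ∈ sideNhd y n, ∀ k, x ∈ bisector y (Heis.toPU21 (latticePt 1 k) • y) ↔ k = n := by
  obtain ⟨x, ha, hτ, hβ⟩ := exists_relHeis_eq_and_shear_eq y (1 / 2) n
  refine ⟨x, ?_, fun k => ?_⟩
  · simp only [sideNhd, Set.mem_ofPred_eq, ha, hτ, hβ]
    norm_num
  · have hdiff : orbitForm x y 1 k - orbitForm x y 0 0 = ((n - k : ℤ) : ℝ) ^ 2 := by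
      simp only [orbitForm, latticeForm, ha, hτ, hβ]
      push_cast
      ring
    rw [mem_bisector_latticePt_smul_iff, eq_comm, ← sub_eq_zero, hdiff, sq_eq_zero_iff,
      Int.cast_eq_zero, sub_eq_zero, eq_comm]

theorem latticePt_one_smul_ne (y : CH2) (n : ℤ) : Heis.toPU21 (latticePt 1 n) • y ≠ y := by
  intro h
  have hheis : latticePt 1 n * y.heis = y.heis := by rw [← CH2.heis_toPU21_smul, h]
  simpa [latticePt, Heis.one_def] using mul_eq_right.1 hheis

theorem isSide_dirichlet_inter_bisector (y : CH2) (n : ℤ) :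
    IsSide latticeGroup y
      (dirichlet latticeGroup y ∩ bisector y (Heis.toPU21 (latticePt 1 n) • y)) := by
  obtain ⟨x, hx, hbis⟩ := exists_mem_sideNhd_forall_mem_bisector_iff y n
  exact ⟨_, (mem_latticeGroup_iff _).2 ⟨1, n, rfl⟩, latticePt_one_smul_ne y n, rfl,
    sideNhd y n, isOpen_sideNhd y n, ⟨x, hx, (hbis n).2 rfl⟩,
    Set.subset_inter (sideNhd_inter_bisector_subset_dirichlet y n) Set.inter_subset_right⟩

theorem injective_dirichlet_inter_bisector (y : CH2) :
    Function.Injective fun n : ℤ =>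
      dirichlet latticeGroup y ∩ bisector y (Heis.toPU21 (latticePt 1 n) • y) := by
  intro n k (hnk : _ ∩ _ = _ ∩ _)
  obtain ⟨x, hx, hbis⟩ := exists_mem_sideNhd_forall_mem_bisector_iff y n
  have hxn := (hbis n).2 rfl
  have hxk := hnk.subset ⟨sideNhd_inter_bisector_subset_dirichlet y n ⟨hx, hxn⟩, hxn⟩
  exact ((hbis k).1 hxk.2).symm

theorem infinite_isSide_latticeGroup (y : CH2) : {S | IsSide latticeGroup y S}.Infinite :=
  Set.infinite_of_injective_forall_mem (injective_dirichlet_inter_bisector y)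
    (isSide_dirichlet_inter_bisector y)

end IntegerLattice

end CHyp

theorem theorem3p2 (G : Subgroup CHyp.PU21)
    (hG : ∃ h : CHyp.PU21,
      G = (CHyp.integerLattice.map CHyp.Heis.toPU21).map (MulAut.conj h).toMonoidHom)
    (y : CHyp.CH2) :
    {S : Set CHyp.CH2 | CHyp.IsSide G y S}.Infinite := by
  obtain ⟨h, rfl⟩ := hG
  exact CHyp.infinite_isSide_conj CHyp.infinite_isSide_latticeGroup h y
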